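/- Setting. Let $S$ and $A$ be nonempty compact metric spaces, $E$ a Polish space, and $E^0$ a Polish space with a compatible metric $d_{E^0}$. For a Polish space $X$ let $\mathcal P(X)$ be the set of Borel probability measures on $X$ with the topology of weak convergence and its Borel $\sigma$-algebra. Let $\mathcal W_{\mathcal P(S)}$ be the 1-Wasserstein distance on $\mathcal P(S)$ for $d_S$, and $\mathcal W_{\mathcal P(S\times A)}$ the 1-Wasserstein distance on $\mathcal P(S\times A)$ for the metric $d_S+d_A$, i.e. the infimum over all couplings of the expected distance. Let $\lambda_\varepsilon\in\mathcal P(E)$, let $\mathrm F:S\times A\times\mathcal P(S\times A)\times E\times E^0\to S$ and $r:S\times A\times\mathcal P(S\times A)\to\mathbb R$ be Borel measurable, let $\beta\in[0,1)$, and let $\mathfrak P^0\subseteq\mathcal P(E^0)$ be nonempty. For $\Lambda\in\mathcal P(S\times A)$ let $\operatorname{pj}_S(\Lambda)$ be its marginal on $S$; for $\mu\in\mathcal P(S)$ let $\mathfrak U(\mu)=\{\Lambda\in\mathcal P(S\times A):\operatorname{pj}_S(\Lambda)=\mu\}$. For $\mu\in\mathcal P(S)$, $\Lambda\in\mathfrak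 U(\mu)$, $e^0\in E^0$ and $p\in\mathcal P(E^0)$ put $$\overline{\mathrm F}(\mu,\Lambda,e^0)=(\Lambda\otimes\lambda_\varepsilon)\circ \mathrm F(\cdot,\cdot,\Lambda,\cdot,e^0)^{-1}\in\mathcal P(S),\qquad \overline p(\cdot\,|\,\mu,\Lambda,p)=p\circ\overline{\mathrm F}(\mu,\Lambda,\cdot)^{-1}\in\mathcal P(\mathcal P(S)),$$ $$\overline r(\mu,\Lambda)=\int_{S\times A} r(s,a,\Lambda)\,\Lambda(ds,da),$$ and, for bounded continuous $\overline V:\mathcal P(S)\to\mathbb R$, $$\mathcal T\overline V(\mu)=\sup_{\Lambda\in\mathfrak U(\mu)}\Big\{\overline r(\mu,\Lambda)+\beta\inf_{p\in\mathfrak P^0}\int_{\mathcal P(S)}\overline V(\mu')\,\overline p(d\mu'|\mu,\Lambda,p)\Big\}.$$ Proposition 2.4. Assume that $\mathfrak P^0$ is compact and that there are constants $\overline C_{\mathrm F},\overline C_r>0$ such that, for all $s,\tilde s\in S$, $a,\tilde a\in A$, $\Lambda,\tilde\Lambda\in\mathcal P(S\times A)$ and $e^0,\tilde e^0\in E^0$,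 $$\int_E d_S\big(\mathrm F(s,a,\Lambda,e,e^0),\mathrm F(\tilde s,\tilde a,\tilde\Lambda,e,\tilde e^0)\big)\lambda_\varepsilon(de)\le\overline C_{\mathrm F}\big(d_S(s,\tilde s)+d_A(a,\tilde a)+\mathcal W_{\mathcal P(S\times A)}(\Lambda,\tilde\Lambda)+d_{E^0}(e^0,\tilde e^0)\big),$$ $$|r(s,a,\Lambda)-r(\tilde s,\tilde a,\tilde\Lambda)|\le\overline C_r\big(d_S(s,\tilde s)+d_A(a,\tilde a)+\mathcal W_{\mathcal P(S\times A)}(\Lambda,\tilde\Lambda)\big).$$ Then for every $L\ge0$ and every bounded $\overline V:\mathcal P(S)\to\mathbb R$ that is $L$-Lipschitz with respect to $\mathcal W_{\mathcal P(S)}$: (i) there is a Borel measurable map $\overline p^*:\mathcal P(S\times A)\to\mathcal P(E^0)$ with $\overline p^*(\Lambda)\in\mathfrak P^0$ and $$\int_{\mathcal P(S)}\overline V(\mu')\,\overline p(d\mu'|\operatorname{pj}_S(\Lambda),\Lambda,\overline p^*(\Lambda))=\inf_{p\in\mathfrak P^0}\int_{\mathcal P(S)}\overline V(\mu')\,\overline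 p(d\mu'|\operatorname{pj}_S(\Lambda),\Lambda,p)\quad\text{for every }\Lambda\in\mathcal P(S\times A);$$ (ii) there is a Borel measurable map $\overline\pi^*:\mathcal P(S)\to\mathcal P(S\times A)$ with $\overline\pi^*(\mu)\in\mathfrak U(\mu)$ and $$\overline r(\mu,\overline\pi^*(\mu))+\beta\inf_{p\in\mathfrak P^0}\int_{\mathcal P(S)}\overline V(\mu')\,\overline p(d\mu'|\mu,\overline\pi^*(\mu),p)=\mathcal T\overline V(\mu)\quad\text{for every }\mu\in\mathcal P(S).$$ -/

import Mathlib

open MeasureTheory Topology Set Filter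

set_option linter.unusedSectionVars false
set_option linter.style.haveILetI false

noncomputable section

namespace RobustMFC

/-! ### The Borel σ-algebra of the weak topology

`ProbabilityMeasure X` carries the topology of weak convergence and the σ-algebra generated by the
evaluations at Borel sets.  For a separable metrizable `X` the latter is the Borel σ-algebra of the
former, so that "measurable" below always means "Borel measurable" for the weak topology. -/

section Borel

variable {X : Type*} [TopologicalSpace X] [TopologicalSpace.PseudoMetrizableSpace X]
  [SecondCountableTopology X] [MeasurableSpace X] [BorelSpace X]

/-- Finite unions of elements of a fixed countable basis of open sets. -/
def basicOpens (X : Type*) [TopologicalSpace X] [SecondCountableTopology X] : Set (Set X) :=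
  (fun t => ⋃₀ t) '' {t : Set (Set X) | t.Finite ∧ t ⊆ TopologicalSpace.countableBasis X}

/-- A countable subbasis of the weak topology. -/
def weakSubbasis (X : Type*) [TopologicalSpace X] [SecondCountableTopology X]
    [MeasurableSpace X] : Set (Set (ProbabilityMeasure X)) :=
  ⋃ U ∈ basicOpens X, range fun q : ℚ => {μ | ENNReal.ofReal (q : ℝ) < (μ : Measure X) U}

theorem countable_weakSubbasis (X : Type*) [TopologicalSpace X] [SecondCountableTopology X]
    [MeasurableSpace X] : (weakSubbasis X).Countable := by
  refine Countable.biUnion ?_ fun U _ => countable_range _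
  exact (countable_ofPred_finite_subset (TopologicalSpace.countable_countableBasis X)).image _

theorem isOpen_of_mem_basicOpens {U : Set X} (hU : U ∈ basicOpens X) : IsOpen U := by
  obtain ⟨t, ⟨-, ht⟩, rfl⟩ := hU
  exact isOpen_sUnion fun s hs => TopologicalSpace.isOpen_of_mem_countableBasis (ht hs)

theorem isOpen_setOf_lt_measure {U : Set X} (hU : IsOpen U) (c : ENNReal) :
    IsOpen {μ : ProbabilityMeasure X | c < (μ : Measure X) U} := by
  letI := TopologicalSpace.pseudoMetrizableSpacePseudoMetric X
  rw [isOpen_iff_mem_nhds]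
  intro μ hμ
  have h := ProbabilityMeasure.le_liminf_measure_open_of_tendsto (L := 𝓝 μ) (μ := μ)
    (μs := id) tendsto_id hU
  exact Filter.eventually_lt_of_lt_liminf (lt_of_lt_of_le hμ h)

/-- Every open set is exhausted, in measure, by finite unions of basic open sets. -/
theorem exists_basicOpens_lt {G : Set X} (hG : IsOpen G) (μ : Measure X) {c : ENNReal}
    (hc : c < μ G) : ∃ U ∈ basicOpens X, U ⊆ G ∧ c < μ U := by
  obtain ⟨T, hT, rfl⟩ :=
    (TopologicalSpace.isBasis_countableBasis X).open_eq_sUnion hG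
  have hTc : T.Countable := (TopologicalSpace.countable_countableBasis X).mono hT
  rcases T.eq_empty_or_nonempty with rfl | hne
  · simp at hc
  obtain ⟨f, rfl⟩ := hTc.exists_eq_range hne
  rw [sUnion_range, measure_iUnion_eq_iSup_accumulate] at hc
  obtain ⟨n, hn⟩ := lt_iSup_iff.1 hc
  refine ⟨accumulate f n, ⟨f '' Iic n, ⟨(finite_Iic n).image f, ?_⟩, ?_⟩, ?_, hn⟩
  · exact (image_subset_range f _).trans hT
  · simp [accumulate_def, sUnion_image]
  · rw [sUnion_range]
    exact accumulate_subset_iUnion n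

theorem weakTopology_eq_generateFrom :
    (inferInstance : TopologicalSpace (ProbabilityMeasure X)) =
      TopologicalSpace.generateFrom (weakSubbasis X) := by
  letI := TopologicalSpace.pseudoMetrizableSpacePseudoMetric X
  apply le_antisymm
  · refine le_generateFrom fun s hs => ?_
    simp only [weakSubbasis, mem_iUnion] at hs
    obtain ⟨U, hU, q, rfl⟩ := hs
    exact isOpen_setOf_lt_measure (isOpen_of_mem_basicOpens hU) _
  · refine (le_iff_nhds _ _).2 fun μ => ?_
    have : (@nhds _ (TopologicalSpace.generateFrom (weakSubbasis X)) μ).IsCountablyGenerated := by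
      letI : TopologicalSpace (ProbabilityMeasure X) :=
        TopologicalSpace.generateFrom (weakSubbasis X)
      haveI : SecondCountableTopology (ProbabilityMeasure X) :=
        ⟨weakSubbasis X, countable_weakSubbasis X, rfl⟩
      infer_instance
    have key := @tendsto_of_forall_isOpen_le_liminf' X _ _ _ _ μ id
      (@nhds _ (TopologicalSpace.generateFrom (weakSubbasis X)) μ) this
    refine key fun G hG => ?_
    refine le_of_forall_lt fun c hc => ?_
    obtain ⟨c', hcc', hc'⟩ := exists_between hc
    obtain ⟨U, hU, hUG, hlt⟩ := exists_basicOpens_lt hG (μ : Measure X) hc'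
    obtain ⟨q, -, h1, h2⟩ := ENNReal.lt_iff_exists_rat_btwn.1 hlt
    refine lt_of_lt_of_le hcc' (le_liminf_of_le (by isBoundedDefault) ?_)
    have hmem : {ν : ProbabilityMeasure X | ENNReal.ofReal (q : ℝ) < (ν : Measure X) U} ∈
        @nhds _ (TopologicalSpace.generateFrom (weakSubbasis X)) μ := by
      refine @IsOpen.mem_nhds _ (TopologicalSpace.generateFrom (weakSubbasis X)) μ _ ?_ ?_
      · exact TopologicalSpace.isOpen_generateFrom_of_mem (mem_biUnion hU ⟨q, rfl⟩)
      · exact h2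
    filter_upwards [hmem] with ν hν
    have hν' : ENNReal.ofReal (q : ℝ) < (ν : Measure X) U := hν
    exact (lt_trans h1 hν').le.trans (measure_mono hUG)

instance secondCountableTopology_probabilityMeasure :
    SecondCountableTopology (ProbabilityMeasure X) :=
  ⟨weakSubbasis X, countable_weakSubbasis X, weakTopology_eq_generateFrom⟩

instance borelSpace_probabilityMeasure : BorelSpace (ProbabilityMeasure X) := by
  constructor
  apply le_antisymm
  · have hmeas : ∀ s : Set X, MeasurableSet s →
        @Measurable _ _ (borel (ProbabilityMeasure X)) _
          fun μ : ProbabilityMeasure X => (μ : Measure X) s := by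
      letI : MeasurableSpace (ProbabilityMeasure X) := borel _
      haveI : BorelSpace (ProbabilityMeasure X) := ⟨rfl⟩
      intro s hs
      induction s, hs using MeasurableSpace.induction_on_inter
        (BorelSpace.measurable_eq (α := X)) isPiSystem_isOpen with
      | empty => simp
      | basic U hU =>
        exact measurable_of_Ioi fun c => (isOpen_setOf_lt_measure hU c).measurableSet
      | compl t ht ih =>
        have : (fun μ : ProbabilityMeasure X => (μ : Measure X) tᶜ) =
            fun μ : ProbabilityMeasure X => 1 - (μ : Measure X) t := by
          funext μ; exact prob_compl_eq_one_sub ht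
        rw [this]; exact measurable_const.sub ih
      | iUnion f hd hf ih =>
        have : (fun μ : ProbabilityMeasure X => (μ : Measure X) (⋃ i, f i)) =
            fun μ : ProbabilityMeasure X => ∑' i, (μ : Measure X) (f i) := by
          funext μ; exact measure_iUnion hd hf
        rw [this]; exact Measurable.tsum ih
    have hsub : @Measurable _ _ (borel (ProbabilityMeasure X)) _
        (fun μ : ProbabilityMeasure X => (μ : Measure X)) :=
      @Measure.measurable_of_measurable_coe _ _ _ (borel (ProbabilityMeasure X)) _ hmeas
    exact measurable_iff_comap_le.1 hsub
  · rw [borel_eq_generateFrom_of_subbasis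
      (weakTopology_eq_generateFrom (X := X))]
    refine MeasurableSpace.generateFrom_le fun s hs => ?_
    simp only [weakSubbasis, mem_iUnion] at hs
    obtain ⟨U, hU, q, rfl⟩ := hs
    have : Measurable fun μ : ProbabilityMeasure X => (μ : Measure X) U :=
      (Measure.measurable_coe (isOpen_of_mem_basicOpens hU).measurableSet).comp
        measurable_subtype_coe
    exact this measurableSet_Ioi

end Borel

/-! ### Wasserstein distances -/

section Wasserstein

variable {X : Type*} [MeasurableSpace X]

/-- `Γ` is a coupling of `μ` and `ν`. -/
def IsCoupling (μ ν : ProbabilityMeasure X) (Γ : ProbabilityMeasure (X × X)) : Prop :=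
  Γ.map measurable_fst.aemeasurable = μ ∧ Γ.map measurable_snd.aemeasurable = ν

/-- The optimal transport cost between `μ` and `ν` for the cost function `c`. -/
def transportCost (c : X → X → ℝ) (μ ν : ProbabilityMeasure X) : ℝ :=
  ⨅ Γ : {Γ : ProbabilityMeasure (X × X) // IsCoupling μ ν Γ},
    ∫ z, c z.1 z.2 ∂(Γ.1 : Measure (X × X))

end Wasserstein

/-- The 1-Wasserstein distance on `𝒫(S)`. -/
def wasserstein {S : Type*} [MetricSpace S] [MeasurableSpace S]
    (μ ν : ProbabilityMeasure S) : ℝ :=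
  transportCost dist μ ν

/-- The 1-Wasserstein distance on `𝒫(S × A)`, where `S × A` carries the metric
`d((s, a), (s', a')) = d(s, s') + d(a, a')`. -/
def wassersteinProd {S A : Type*} [MetricSpace S] [MeasurableSpace S]
    [MetricSpace A] [MeasurableSpace A] (Λ Λ' : ProbabilityMeasure (S × A)) : ℝ :=
  transportCost (fun x y => dist x.1 y.1 + dist x.2 y.2) Λ Λ'

/-- `Lip_{b,L}(𝒫(S); ℝ)`: bounded functions that are `L`-Lipschitz for the Wasserstein distance. -/
def LipB (S : Type*) [MetricSpace S] [MeasurableSpace S] (L : ℝ) :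
    Set (ProbabilityMeasure S → ℝ) :=
  {V | (∃ C : ℝ, ∀ μ, |V μ| ≤ C) ∧ ∀ μ ν, |V μ - V ν| ≤ L * wasserstein μ ν}

/-! ### The lifted model -/

section Lifted

variable {S A E E₀ : Type*} [MeasurableSpace S] [MeasurableSpace A] [MeasurableSpace E]
  [MeasurableSpace E₀]

/-- The marginal on `S` of a probability measure on `S × A`. -/
def pjS (Λ : ProbabilityMeasure (S × A)) : ProbabilityMeasure S :=
  Λ.map measurable_fst.aemeasurable

/-- The correspondence `𝔘`: all `Λ ∈ 𝒫(S × A)` with `S`-marginal `μ`. -/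
def admissible (A : Type*) [MeasurableSpace A] (μ : ProbabilityMeasure S) :
    Set (ProbabilityMeasure (S × A)) :=
  {Λ | pjS Λ = μ}

/-- The graph of `𝔘`. -/
def GraphU (S A : Type*) [MeasurableSpace S] [MeasurableSpace A] : Type _ :=
  {x : ProbabilityMeasure S × ProbabilityMeasure (S × A) // x.2 ∈ admissible A x.1}

/-- The point `(μ, Λ)` of the graph of `𝔘`. -/
def GraphU.mk (μ : ProbabilityMeasure S) (Λ : ProbabilityMeasure (S × A))
    (h : Λ ∈ admissible A μ) : GraphU S A :=
  ⟨(μ, Λ), h⟩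

/-- The component `Λ` of a point `(μ, Λ)` of the graph of `𝔘`. -/
def GraphU.law (x : GraphU S A) : ProbabilityMeasure (S × A) := x.1.2

theorem measurable_section {F : S × A × ProbabilityMeasure (S × A) × E × E₀ → S}
    (hF : Measurable F) (Λ : ProbabilityMeasure (S × A)) (e₀ : E₀) :
    Measurable fun z : (S × A) × E => F (z.1.1, z.1.2, Λ, z.2, e₀) :=
  hF.comp (by fun_prop)

/-- The lifted transition function: the push-forward of `Λ ⊗ lamE` under
`F(·, ·, Λ, ·, e₀)`. -/
def liftedF (lamE : ProbabilityMeasure E)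
    {F : S × A × ProbabilityMeasure (S × A) × E × E₀ → S} (hF : Measurable F)
    (x : GraphU S A) (e₀ : E₀) : ProbabilityMeasure S :=
  (x.law.prod lamE).map (measurable_section hF x.law e₀).aemeasurable

theorem measurable_liftedF (lamE : ProbabilityMeasure E)
    {F : S × A × ProbabilityMeasure (S × A) × E × E₀ → S} (hF : Measurable F)
    (x : GraphU S A) : Measurable (liftedF lamE hF x) := by
  refine Measurable.subtype_mk ?_
  refine Measure.measurable_of_measurable_coe _ fun s hs => ?_
  have hF' : Measurable fun w : E₀ × ((S × A) × E) =>
      F (w.2.1.1, w.2.1.2, x.law, w.2.2, w.1) := hF.comp (by fun_prop)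
  have := measurable_measure_prodMk_left
    (ν := ((x.law.prod lamE : ProbabilityMeasure _) : Measure ((S × A) × E))) (hF' hs)
  convert this using 2 with e₀
  exact Measure.map_apply (measurable_section hF x.law e₀) hs

/-- The lifted kernel: the push-forward of `p` under the lifted transition function. -/
def liftedKernel (lamE : ProbabilityMeasure E)
    {F : S × A × ProbabilityMeasure (S × A) × E × E₀ → S} (hF : Measurable F)
    (x : GraphU S A) (p : ProbabilityMeasure E₀) :
    ProbabilityMeasure (ProbabilityMeasure S) :=
  p.map (measurable_liftedF lamE hF x).aemeasurable

/-- The lifted reward. -/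
def liftedReward (r : S × A × ProbabilityMeasure (S × A) → ℝ) (x : GraphU S A) : ℝ :=
  ∫ z, r (z.1, z.2, x.law) ∂(x.law : Measure (S × A))

/-- The worst-case expectation `inf_{p ∈ P0} ∫ V dp̄(· | μ, Λ, p)`. -/
def worstCase (lamE : ProbabilityMeasure E)
    {F : S × A × ProbabilityMeasure (S × A) × E × E₀ → S} (hF : Measurable F)
    (P0 : Set (ProbabilityMeasure E₀)) (V : ProbabilityMeasure S → ℝ) (x : GraphU S A) : ℝ :=
  ⨅ p : P0, ∫ μ', V μ' ∂(liftedKernel lamE hF x p.1 : Measure (ProbabilityMeasure S))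

/-- The Bellman–Isaacs operator. -/
def bellmanIsaacs (lamE : ProbabilityMeasure E)
    {F : S × A × ProbabilityMeasure (S × A) × E × E₀ → S} (hF : Measurable F)
    (r : S × A × ProbabilityMeasure (S × A) → ℝ) (β : ℝ)
    (P0 : Set (ProbabilityMeasure E₀)) (V : ProbabilityMeasure S → ℝ)
    (μ : ProbabilityMeasure S) : ℝ :=
  ⨆ Λ : admissible A μ,
    (liftedReward r (GraphU.mk μ Λ.1 Λ.2) +
      β * worstCase lamE hF P0 V (GraphU.mk μ Λ.1 Λ.2))

end Lifted

/-! ### Regularity assumptions -/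

section Assumptions

variable {S A E E₀ : Type*} [MetricSpace S] [MeasurableSpace S] [MetricSpace A]
  [MeasurableSpace A] [MeasurableSpace E] [MetricSpace E₀]

/-- The transition function is Lipschitz in `(s, a, Λ, e₀)`, on average over the idiosyncratic
noise. -/
def LipschitzTransition (lamE : ProbabilityMeasure E)
    (F : S × A × ProbabilityMeasure (S × A) × E × E₀ → S) : Prop :=
  ∃ C : ℝ, 0 < C ∧ ∀ (s s' : S) (a a' : A) (Λ Λ' : ProbabilityMeasure (S × A)) (e₀ e₀' : E₀),
    ∫ e, dist (F (s, a, Λ, e, e₀)) (F (s', a', Λ', e, e₀')) ∂(lamE : Measure E) ≤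
      C * (dist s s' + dist a a' + wassersteinProd Λ Λ' + dist e₀ e₀')

/-- The reward function is Lipschitz in `(s, a, Λ)`. -/
def LipschitzReward (r : S × A × ProbabilityMeasure (S × A) → ℝ) : Prop :=
  ∃ C : ℝ, 0 < C ∧ ∀ (s s' : S) (a a' : A) (Λ Λ' : ProbabilityMeasure (S × A)),
    |r (s, a, Λ) - r (s', a', Λ')| ≤ C * (dist s s' + dist a a' + wassersteinProd Λ Λ')

end Assumptions

end RobustMFC

end

namespace RobustMFC

open scoped ENNReal NNReal

/-! ### Couplings of mixtures -/

section Partition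

variable {X : Type*} [PseudoMetricSpace X] [CompactSpace X] [MeasurableSpace X] [BorelSpace X]

/-! The result is a measurable maximum theorem, and the work lies in continuity for the weak
topologies. Write `G (Λ, p)` for the integral of `V` against the lifted kernel. If `G` is jointly
continuous, then the infimum over the compact set `P0` is continuous in `Λ`, and so is the objective
`J`, the reward plus `β` times that infimum. The minimizing `p` form a closed-graph correspondence
into `P0`. The admissible `Λ` form one into the compact space of laws on `S × A`, because the
marginal map is continuous. `exists_measurable_minimizer` then gives both selections.

Continuity of `G` combines two facts. First, any coupling of `Λ` and `Λ'`, run through `F` with a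
common noise, couples the two lifted transitions (`wasserstein_liftedF_le`), so the integrand is
Lipschitz in `(Λ, e₀)`. Second, weak convergence on a compact space forces the transport cost to
zero (`tendsto_transportCost`): cut the space into small cells with null frontier, couple inside the
cells, and pay the diameter only for the vanishing mass that must change cell.

Selections come from minimizing, one after another, the distances to a dense sequence. By
compactness a point survives, and its distances determine it. -/

theorem exists_null_frontier_partition (μ : Measure X) [IsFiniteMeasure μ] {ε : ℝ} (hε : 0 < ε) :
    ∃ (N : ℕ) (B : ℕ → Set X), (∀ i, MeasurableSet (B i)) ∧ (∀ i, μ (frontier (B i)) = 0) ∧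
      Pairwise (Function.onFun Disjoint B) ∧ ⋃ i ∈ Finset.range N, B i = univ ∧
      ∀ i, ∀ x ∈ B i, ∀ y ∈ B i, dist x y ≤ ε := by
  -- Frontiers for different radii are disjoint, so a finite measure charges only countably many of
  -- them. Radii below `ε / 2` keep the diameter within `ε`.
  have hr : ∀ x : X, ∃ r ∈ Ioo 0 (ε / 2), μ (frontier (Metric.ball x r)) = 0 := fun x => by
    simpa only [Metric.thickening_singleton] using
      exists_null_frontier_thickening μ {x} (half_pos hε)
  choose r hr hr0 using hr
  obtain ⟨t, -, ht⟩ := isCompact_univ.elim_nhds_subcover (fun x => Metric.ball x (r x))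
    fun x _ => Metric.ball_mem_nhds x (hr x).1
  let f : ℕ → Set X := fun n =>
    if h : n < t.card then Metric.ball (t.equivFin.symm ⟨n, h⟩ : X) (r (t.equivFin.symm ⟨n, h⟩))
    else ∅
  have hf : ∀ n, MeasurableSet (f n) ∧ μ (frontier (f n)) = 0 := fun n => by
    by_cases h : n < t.card
    · simp only [f, h, dite_true]
      exact ⟨measurableSet_ball, hr0 _⟩
    · simp [f, h]
  have hD : ∀ n, MeasurableSet (disjointed f n) ∧ μ (frontier (disjointed f n)) = 0 := fun n => by
    refine disjointedRec (p := fun s => MeasurableSet s ∧ μ (frontier s) = 0) ?_ (hf n)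
    rintro s i ⟨hs, hs0⟩
    refine ⟨hs.diff (hf i).1, measure_mono_null ?_ (measure_union_null hs0 (hf i).2)⟩
    rw [sdiff_eq]
    refine (frontier_inter_subset _ _).trans (union_subset_union inter_subset_left ?_)
    rw [frontier_compl]
    exact inter_subset_right
  refine ⟨t.card, disjointed f, fun i => (hD i).1, fun i => (hD i).2, disjoint_disjointed f, ?_, ?_⟩
  · refine eq_univ_of_forall fun x => ?_
    obtain ⟨y, hy, hxy⟩ := mem_iUnion₂.1 (ht (mem_univ x))
    have hx : x ∈ ⋃ n, disjointed f n := by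
      rw [iUnion_disjointed]
      refine mem_iUnion.2 ⟨t.equivFin ⟨y, hy⟩, ?_⟩
      simpa [f] using hxy
    obtain ⟨n, hn⟩ := mem_iUnion.1 hx
    refine mem_iUnion₂.2 ⟨n, ?_, hn⟩
    have := disjointed_subset f n hn
    by_contra h
    simp only [Finset.mem_range] at h
    simp [f, h] at this
  · intro i x hx y hy
    have hx := disjointed_subset f i hx
    have hy := disjointed_subset f i hy
    by_cases h : i < t.card
    · simp only [f, h, dite_true, Metric.mem_ball] at hx hy
      have := dist_triangle_right x y (t.equivFin.symm ⟨i, h⟩ : X)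
      have := (hr (t.equivFin.symm ⟨i, h⟩ : X)).2
      linarith
    · simp [f, h] at hx

end Partition

section Coupling

variable {X : Type*} [MeasurableSpace X]

/-- The measure `μ'` is the conditional law given `B`. On a null set any probability measure serves,
as its weight is zero; hence the guard on the last clause. -/
theorem exists_isProbabilityMeasure_restrict_eq_smul (μ : Measure X) [IsProbabilityMeasure μ]
    {B : Set X} (hB : MeasurableSet B) :
    ∃ μ' : Measure X, IsProbabilityMeasure μ' ∧ μ.restrict B = μ B • μ' ∧
      (μ B ≠ 0 → μ' Bᶜ = 0) := by
  by_cases h : μ B = 0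
  · exact ⟨μ, inferInstance, by simp [h], fun h' => absurd h h'⟩
  · refine ⟨(μ B)⁻¹ • μ.restrict B, ⟨?_⟩, ?_, fun _ => ?_⟩
    · simp [ENNReal.inv_mul_cancel h (measure_ne_top μ B)]
    · rw [smul_smul, ENNReal.mul_inv_cancel h (measure_ne_top μ B), one_smul]
    · simp [Measure.restrict_apply hB.compl]

/-- Mixtures `∑ aᵢ μᵢ` and `∑ bᵢ νᵢ` are coupled by coupling the common mass `min aᵢ bᵢ`
independently inside each component and the excess masses independently of each other. -/
theorem exists_coupling_of_mixture {ι : Type*} (t : Finset ι) (a b : ι → ℝ≥0)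
    (hab : ∑ i ∈ t, a i = ∑ i ∈ t, b i) (μ ν : ι → Measure X)
    [∀ i, IsProbabilityMeasure (μ i)] [∀ i, IsProbabilityMeasure (ν i)]
    (c : X × X → ℝ≥0∞) {M ε : ℝ≥0∞} (hM : ∀ z, c z ≤ M)
    (hε : ∀ i ∈ t, a i ≠ 0 → b i ≠ 0 → ∀ᵐ z ∂(μ i).prod (ν i), c z ≤ ε) :
    ∃ Γ : Measure (X × X), Γ.map Prod.fst = ∑ i ∈ t, a i • μ i ∧
      Γ.map Prod.snd = ∑ i ∈ t, b i • ν i ∧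
      ∫⁻ z, c z ∂Γ ≤ (∑ i ∈ t, a i : ℝ≥0) * ε + (∑ i ∈ t, (a i - b i) : ℝ≥0) * M := by
  set D : ℝ≥0 := ∑ i ∈ t, (a i - b i) with hD
  have hD' : D = ∑ i ∈ t, (b i - a i) := by
    have h : ∑ i ∈ t, (a i - b i) + ∑ i ∈ t, b i = ∑ i ∈ t, (b i - a i) + ∑ i ∈ t, a i := by
      rw [← Finset.sum_add_distrib, ← Finset.sum_add_distrib]
      refine Finset.sum_congr rfl fun i _ => ?_
      rw [tsub_add_eq_max, tsub_add_eq_max, max_comm]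
    rw [hab] at h
    exact add_right_cancel h
  set α : Measure X := ∑ i ∈ t, (a i - b i) • μ i with hα
  set γ : Measure X := ∑ i ∈ t, (b i - a i) • ν i with hγ
  have hαu : α univ = D := by
    simp [hα, hD, Measure.finsetSum_apply, ENNReal.smul_def]
  have hγu : γ univ = D := by
    simp [hγ, hD', Measure.finsetSum_apply, ENNReal.smul_def]
  haveI : IsFiniteMeasure α := ⟨by simp [hαu]⟩
  haveI : IsFiniteMeasure γ := ⟨by simp [hγu]⟩
  -- Both excess measures have mass `D`, so `D⁻¹ • α.prod γ` has marginals `α` and `γ`. For `D = 0`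
  -- they vanish and the convention `0⁻¹ = 0` is harmless.
  have hzero : ∀ (m : Measure X), m univ = D → D⁻¹ • D • m = m := fun m hm => by
    by_cases h : D = 0
    · have : m = 0 := by rw [← Measure.measure_univ_eq_zero, hm, h]; simp
      simp [this]
    · rw [smul_smul, inv_mul_cancel₀ h, one_smul]
  have hmin : ∀ x y : ℝ≥0, min x y + (x - y) = x := fun x y => by
    rcases le_total x y with h | h
    · simp [h, tsub_eq_zero_of_le h]
    · simp [h]
  refine ⟨∑ i ∈ t, min (a i) (b i) • (μ i).prod (ν i) + D⁻¹ • α.prod γ, ?_, ?_, ?_⟩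
  · rw [Measure.map_add _ _ measurable_fst, Measure.map_smul, Measure.map_fst_prod, hγu,
      ← Measure.mapₗ_apply_of_measurable measurable_fst, map_sum]
    simp only [Measure.mapₗ_apply_of_measurable measurable_fst, Measure.map_smul,
      Measure.map_fst_prod, measure_univ, one_smul]
    rw [show ((D : ℝ≥0∞) • α) = D • α from rfl, hzero α hαu, hα, ← Finset.sum_add_distrib]
    refine Finset.sum_congr rfl fun i _ => ?_
    rw [← add_smul, hmin]
  · rw [Measure.map_add _ _ measurable_snd, Measure.map_smul, Measure.map_snd_prod, hαu,
      ← Measure.mapₗ_apply_of_measurable measurable_snd, map_sum]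
    simp only [Measure.mapₗ_apply_of_measurable measurable_snd, Measure.map_smul,
      Measure.map_snd_prod, measure_univ, one_smul]
    rw [show ((D : ℝ≥0∞) • γ) = D • γ from rfl, hzero γ hγu, hγ, ← Finset.sum_add_distrib]
    refine Finset.sum_congr rfl fun i _ => ?_
    rw [← add_smul, min_comm, hmin]
  · rw [lintegral_add_measure, lintegral_finsetSum_measure]
    refine add_le_add ?_ ?_
    · rw [ENNReal.ofNNReal_finsetSum, Finset.sum_mul]
      refine Finset.sum_le_sum fun i hi => ?_
      rw [ENNReal.smul_def, lintegral_smul_measure, smul_eq_mul]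
      by_cases h : min (a i) (b i) = 0
      · simp [h]
      · have h1 : a i ≠ 0 := fun h' => h (by simp [h'])
        have h2 : b i ≠ 0 := fun h' => h (by simp [h'])
        refine mul_le_mul' (by simp) ?_
        calc ∫⁻ z, c z ∂(μ i).prod (ν i) ≤ ∫⁻ _, ε ∂(μ i).prod (ν i) :=
              lintegral_mono_ae (hε i hi h1 h2)
          _ = ε := by simp
    · rw [ENNReal.smul_def, lintegral_smul_measure, smul_eq_mul]
      calc ((D⁻¹ : ℝ≥0) : ℝ≥0∞) * ∫⁻ z, c z ∂α.prod γ
          ≤ ((D⁻¹ : ℝ≥0) : ℝ≥0∞) * (M * (D * D)) := by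
            gcongr
            calc ∫⁻ z, c z ∂α.prod γ ≤ ∫⁻ _, M ∂α.prod γ := lintegral_mono hM
              _ = M * (D * D) := by
                rw [lintegral_const, ← univ_prod_univ, Measure.prod_prod, hαu, hγu]
        _ = ((D⁻¹ * D * D : ℝ≥0) : ℝ≥0∞) * M := by push_cast; ring
        _ ≤ D * M := by
            gcongr
            by_cases h : D = 0
            · simp [h]
            · simp [inv_mul_cancel₀ h]

end Coupling

/-! ### Measurable selection of minimizers -/

section Selection

variable {Y K : Type*} [MeasurableSpace Y] [TopologicalSpace K]

/-- Nonempty closed-valued correspondences that are measurable in the sense that the lower inverse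
image of every closed set is measurable. -/
structure IsMeasurableCorrespondence (φ : Y → Set K) : Prop where
  isClosed : ∀ y, IsClosed (φ y)
  nonempty : ∀ y, (φ y).Nonempty
  measurableSet : ∀ C : Set K, IsClosed C → MeasurableSet {y | (φ y ∩ C).Nonempty}

/-- The minimizers of `f` over the values of a correspondence. -/
def minimizers (f : K → ℝ) (φ : Y → Set K) (y : Y) : Set K :=
  {k | k ∈ φ y ∧ ∀ k' ∈ φ y, f k ≤ f k'}

/-- A minimizer lies in `C` exactly when `φ y` meets `C` and the minimum over `φ y ∩ C` does not
exceed that over `φ y`. The comparison is tested at rational levels, each test being about closed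
sets met by `φ y`. -/
theorem IsMeasurableCorrespondence.minimizers [CompactSpace K] {φ : Y → Set K}
    (hφ : IsMeasurableCorrespondence φ) {f : K → ℝ} (hf : Continuous f) :
    IsMeasurableCorrespondence (minimizers f φ) where
  isClosed y := by
    have : RobustMFC.minimizers f φ y = φ y ∩ ⋂ k' ∈ φ y, {k | f k ≤ f k'} := by
      ext k; simp [RobustMFC.minimizers]
    rw [this]
    exact (hφ.isClosed y).inter
      (isClosed_biInter fun k' _ => isClosed_le hf continuous_const)
  nonempty y := by
    obtain ⟨k, hk, hmin⟩ := (hφ.isClosed y).isCompact.exists_isMinOn (hφ.nonempty y)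
      hf.continuousOn
    exact ⟨k, hk, fun k' hk' => hmin hk'⟩
  measurableSet C hC := by
    have : {y | (RobustMFC.minimizers f φ y ∩ C).Nonempty} = {y | (φ y ∩ C).Nonempty} ∩
        ⋂ q : ℚ, ({y | (φ y ∩ {k | f k ≤ q}).Nonempty}ᶜ ∪
          {y | (φ y ∩ (C ∩ {k | f k ≤ q})).Nonempty}) := by
      ext y
      simp only [mem_inter_iff, mem_iInter, mem_union, mem_compl_iff, mem_ofPred_eq]
      constructor
      · rintro ⟨k, ⟨hk, hmin⟩, hkC⟩
        refine ⟨⟨k, hk, hkC⟩, fun q => or_iff_not_imp_left.2 fun h => ?_⟩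
        obtain ⟨k', hk', hq⟩ := not_not.1 h
        exact ⟨k, hk, hkC, (hmin k' hk').trans hq⟩
      · rintro ⟨hne, hq⟩
        obtain ⟨k, hk, hmin⟩ := ((hφ.isClosed y).inter hC).isCompact.exists_isMinOn hne
          hf.continuousOn
        refine ⟨k, ⟨hk.1, fun k' hk' => ?_⟩, hk.2⟩
        by_contra! hlt
        obtain ⟨q, h1, h2⟩ := exists_rat_btwn hlt
        rcases hq q with h | ⟨k'', hk'', hC'', hle⟩
        · exact h ⟨k', hk', h1.le⟩
        · exact absurd ((hmin ⟨hk'', hC''⟩ : f k ≤ f k'').trans hle) (not_le.2 h2)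
    rw [this]
    refine (hφ.measurableSet C hC).inter (MeasurableSet.iInter fun q => ?_)
    have hq : IsClosed {k | f k ≤ q} := isClosed_le hf continuous_const
    exact (hφ.measurableSet _ hq).compl.union (hφ.measurableSet _ (hC.inter hq))

/-- A measurable compact-valued correspondence has a measurable selection, found by successively
minimizing a countable family of functions that separates points. -/
theorem IsMeasurableCorrespondence.exists_measurable_selection [CompactSpace K]
    [TopologicalSpace.MetrizableSpace K] [MeasurableSpace K] [BorelSpace K] {φ : Y → Set K}
    (hφ : IsMeasurableCorrespondence φ) : ∃ s : Y → K, Measurable s ∧ ∀ y, s y ∈ φ y := by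
  letI := TopologicalSpace.metrizableSpaceMetric K
  rcases isEmpty_or_nonempty Y with hY | ⟨⟨y₀⟩⟩
  · exact ⟨isEmptyElim, measurable_of_empty _, isEmptyElim⟩
  haveI : Nonempty K := ⟨(hφ.nonempty y₀).some⟩
  let f : ℕ → K → ℝ := fun n k => dist k (TopologicalSpace.denseSeq K n)
  have hf : ∀ n, Continuous (f n) := fun n => continuous_id.dist continuous_const
  let Φ : ℕ → Y → Set K := fun n => Nat.rec φ (fun n ψ => RobustMFC.minimizers (f n) ψ) n
  have hΦ : ∀ n, IsMeasurableCorrespondence (Φ n) := fun n => by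
    induction n with
    | zero => exact hφ
    | succ n ih => exact ih.minimizers (hf n)
  have hanti : ∀ y n, Φ (n + 1) y ⊆ Φ n y := fun y n k hk => hk.1
  -- Nested compact sets: `C = univ` makes the selection exist, and general `C` writes its preimage
  -- as a countable intersection of measurable sets.
  have hne : ∀ C : Set K, IsClosed C → ∀ y, (∀ n, (Φ n y ∩ C).Nonempty) →
      (⋂ n, Φ n y ∩ C).Nonempty := fun C hC y h =>
    IsCompact.nonempty_iInter_of_sequence_nonempty_isCompact_isClosed (fun n => Φ n y ∩ C)
      (fun n => inter_subset_inter_left _ (hanti y n)) h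
      (((hΦ 0).isClosed y).inter hC).isCompact fun n => ((hΦ n).isClosed y).inter hC
  -- Two survivors both minimize every `f n` on `Φ n y`, so they have equal distances to a dense
  -- set.
  have huniq : ∀ y k k', (∀ n, k ∈ Φ n y) → (∀ n, k' ∈ Φ n y) → k = k' := fun y k k' hk hk' => by
    have heq : (fun x => dist k x) = fun x => dist k' x :=
      (TopologicalSpace.denseRange_denseSeq K).equalizer (by fun_prop) (by fun_prop) <|
        funext fun n => le_antisymm ((hk (n + 1)).2 k' (hk' n)) ((hk' (n + 1)).2 k (hk n))
    have := congrFun heq k'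
    simpa using this
  have hex : ∀ y, ∃ k, ∀ n, k ∈ Φ n y := fun y => by
    obtain ⟨k, hk⟩ := hne univ isClosed_univ y (by simpa using fun n => (hΦ n).nonempty y)
    exact ⟨k, fun n => (mem_iInter.1 hk n).1⟩
  choose s hs using hex
  refine ⟨s, measurable_of_isClosed fun C hC => ?_, fun y => hs y 0⟩
  have : s ⁻¹' C = ⋂ n, {y | (Φ n y ∩ C).Nonempty} := by
    ext y
    simp only [mem_preimage, mem_iInter, mem_ofPred_eq]
    refine ⟨fun h n => ⟨s y, hs y n, h⟩, fun h => ?_⟩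
    obtain ⟨k, hk⟩ := hne C hC y h
    rw [mem_iInter] at hk
    rw [huniq y (s y) k (hs y) fun n => (hk n).1]
    exact (hk 0).2
  rw [this]
  exact MeasurableSet.iInter fun n => (hΦ n).measurableSet C hC

/-- A correspondence with closed graph in a compact space admits a measurable selection of
minimizers of a continuous function. -/
theorem exists_measurable_minimizer [TopologicalSpace Y] [OpensMeasurableSpace Y] [CompactSpace K]
    [TopologicalSpace.MetrizableSpace K] [MeasurableSpace K] [BorelSpace K] {φ : Y → Set K}
    (hφ : IsClosed {z : Y × K | z.2 ∈ φ z.1}) (hne : ∀ y, (φ y).Nonempty) {f : K → ℝ}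
    (hf : Continuous f) :
    ∃ s : Y → K, Measurable s ∧ ∀ y, s y ∈ φ y ∧ ∀ k ∈ φ y, f (s y) ≤ f k := by
  have h : IsMeasurableCorrespondence φ :=
    { isClosed := fun y => hφ.preimage (f := fun k => (y, k)) (by fun_prop)
      nonempty := hne
      measurableSet := fun C hC => by
        -- This is the projection of a closed set along the compact factor `K`, hence closed.
        have : {y | (φ y ∩ C).Nonempty} =
            Prod.fst '' ({z : Y × K | z.2 ∈ φ z.1} ∩ Prod.snd ⁻¹' C) := by
          ext y
          simp [Set.Nonempty]
        rw [this]
        exact (isClosedMap_fst_of_compactSpace _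
          (hφ.inter (hC.preimage continuous_snd))).measurableSet }
  exact (h.minimizers hf).exists_measurable_selection

end Selection

/-! ### Continuity of transport costs -/

section TransportCost

variable {X : Type*} [MeasurableSpace X]

theorem isCoupling_prod (μ ν : ProbabilityMeasure X) : IsCoupling μ ν (μ.prod ν) := by
  constructor <;> apply Subtype.ext <;> simp [ProbabilityMeasure.map]

theorem transportCost_nonneg {c : X → X → ℝ} (hc : ∀ x y, 0 ≤ c x y)
    (μ ν : ProbabilityMeasure X) : 0 ≤ transportCost c μ ν :=
  Real.iInf_nonneg fun _ => integral_nonneg fun _ => hc _ _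

theorem transportCost_le {c : X → X → ℝ} (hc : ∀ x y, 0 ≤ c x y) {μ ν : ProbabilityMeasure X}
    {Γ : ProbabilityMeasure (X × X)} (hΓ : IsCoupling μ ν Γ) :
    transportCost c μ ν ≤ ∫ z, c z.1 z.2 ∂(Γ : Measure (X × X)) :=
  ciInf_le (f := fun Γ : {Γ : ProbabilityMeasure (X × X) // IsCoupling μ ν Γ} =>
      ∫ z, c z.1 z.2 ∂(Γ.1 : Measure (X × X)))
    ⟨0, by rintro _ ⟨Γ, rfl⟩; exact integral_nonneg fun _ => hc _ _⟩ ⟨Γ, hΓ⟩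

/-- An affine bound by the cost of every coupling is a bound by the transport cost. -/
theorem le_mul_transportCost_add {c : X → X → ℝ} {μ ν : ProbabilityMeasure X} {u v C : ℝ}
    (hC : 0 < C) (h : ∀ Γ : ProbabilityMeasure (X × X), IsCoupling μ ν Γ →
      u ≤ C * ∫ z, c z.1 z.2 ∂(Γ : Measure (X × X)) + v) :
    u ≤ C * transportCost c μ ν + v := by
  -- Without a coupling the real infimum would take its default value `0`. No optimal coupling is
  -- needed.
  haveI : Nonempty {Γ : ProbabilityMeasure (X × X) // IsCoupling μ ν Γ} :=
    ⟨⟨_, isCoupling_prod μ ν⟩⟩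
  have : (u - v) / C ≤ transportCost c μ ν := le_ciInf fun Γ => by
    rw [div_le_iff₀ hC]
    linarith [h Γ.1 Γ.2]
  rw [div_le_iff₀ hC] at this
  linarith

/-- Measures whose masses on the cells of a partition into sets of small diameter are close have a
coupling of low cost. -/
theorem exists_isCoupling_integral_le {N : ℕ} {B : ℕ → Set X} (hB : ∀ i, MeasurableSet (B i))
    (hdisj : Pairwise (Function.onFun Disjoint B)) (hun : ⋃ i ∈ Finset.range N, B i = univ)
    {c : X → X → ℝ} (hcm : Measurable (Function.uncurry c)) (hc : ∀ x y, 0 ≤ c x y)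
    {M ε : ℝ} (hM : ∀ x y, c x y ≤ M) (hM0 : 0 ≤ M) (hε0 : 0 ≤ ε)
    (hε : ∀ i, ∀ x ∈ B i, ∀ y ∈ B i, c x y ≤ ε)
    (μ ν : ProbabilityMeasure X) :
    ∃ Γ : ProbabilityMeasure (X × X), IsCoupling μ ν Γ ∧
      ∫ z, c z.1 z.2 ∂(Γ : Measure (X × X)) ≤
        ε + (∑ i ∈ Finset.range N, (μ (B i) - ν (B i)) : ℝ≥0) * M := by
  have hdec : ∀ κ : ProbabilityMeasure X, ∃ κ' : ℕ → Measure X,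
      (∀ i, IsProbabilityMeasure (κ' i)) ∧ (κ : Measure X) = ∑ i ∈ Finset.range N, κ (B i) • κ' i ∧
        ∀ i, κ (B i) ≠ 0 → κ' i (B i)ᶜ = 0 := fun κ => by
    choose κ' h1 h2 h3 using fun i =>
      exists_isProbabilityMeasure_restrict_eq_smul (κ : Measure X) (hB i)
    refine ⟨κ', h1, ?_, fun i hi => h3 i fun h => hi ?_⟩
    · have : (κ : Measure X) = (κ : Measure X).restrict (⋃ i ∈ Finset.range N, B i) := by
        rw [hun, Measure.restrict_univ]
      refine Measure.ext fun s hs => ?_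
      have hs' : s = ⋃ i ∈ Finset.range N, s ∩ B i := by
        rw [← inter_iUnion₂, hun, inter_univ]
      conv_lhs => rw [hs']
      rw [measure_biUnion_finset (fun i _ j _ hij => (hdisj hij).mono inter_subset_right
        inter_subset_right) fun i _ => hs.inter (hB i), Measure.finsetSum_apply]
      refine Finset.sum_congr rfl fun i _ => ?_
      rw [← Measure.restrict_apply hs, h2 i, ENNReal.smul_def,
        ProbabilityMeasure.ennreal_coeFn_eq_coeFn_toMeasure]
    · exact (ProbabilityMeasure.null_iff_toMeasure_null κ _).2 h
  have hmass : ∀ κ : ProbabilityMeasure X, ∑ i ∈ Finset.range N, κ (B i) = 1 := fun κ => by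
    rw [← ENNReal.coe_inj]
    push_cast
    simp only [ProbabilityMeasure.ennreal_coeFn_eq_coeFn_toMeasure]
    rw [← measure_biUnion_finset (fun i _ j _ hij => hdisj hij) fun i _ => hB i, hun, measure_univ]
  obtain ⟨μ', hμ1, hμ2, hμ3⟩ := hdec μ
  obtain ⟨ν', hν1, hν2, hν3⟩ := hdec ν
  obtain ⟨Γ, hΓ1, hΓ2, hΓ3⟩ := exists_coupling_of_mixture (Finset.range N) (fun i => μ (B i))
    (fun i => ν (B i)) (by rw [hmass, hmass]) μ' ν' (fun z => ENNReal.ofReal (c z.1 z.2))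
    (M := ENNReal.ofReal M) (ε := ENNReal.ofReal ε)
    (fun z => ENNReal.ofReal_le_ofReal (hM _ _)) (fun i _ ha hb => by
      have h1 : ∀ᵐ z ∂(μ' i).prod (ν' i), z.1 ∈ B i :=
        Measure.quasiMeasurePreserving_fst.ae (p := (· ∈ B i)) (hμ3 i ha)
      have h2 : ∀ᵐ z ∂(μ' i).prod (ν' i), z.2 ∈ B i :=
        Measure.quasiMeasurePreserving_snd.ae (p := (· ∈ B i)) (hν3 i hb)
      filter_upwards [h1, h2] with z hz1 hz2
      exact ENNReal.ofReal_le_ofReal (hε i _ hz1 _ hz2))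
  rw [← hμ2] at hΓ1
  rw [← hν2] at hΓ2
  haveI : IsProbabilityMeasure Γ := ⟨by
    rw [← preimage_univ (f := Prod.fst), ← Measure.map_apply measurable_fst MeasurableSet.univ, hΓ1,
      measure_univ]⟩
  refine ⟨⟨Γ, inferInstance⟩, ⟨Subtype.ext hΓ1, Subtype.ext hΓ2⟩, ?_⟩
  change ∫ z, c z.1 z.2 ∂Γ ≤ _
  rw [integral_eq_lintegral_of_nonneg_ae (ae_of_all _ fun _ => hc _ _)
    hcm.aestronglyMeasurable]
  refine ENNReal.toReal_le_of_le_ofReal (by positivity) (hΓ3.trans_eq ?_)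
  rw [hmass, ENNReal.ofReal_add hε0 (by positivity), ENNReal.ofReal_mul (by positivity),
    ENNReal.ofReal_coe_nnreal, ENNReal.coe_one, one_mul]

/-- Weak convergence on a compact metric space implies convergence in transport cost, for every
cost that is dominated by a multiple of the distance. -/
theorem tendsto_transportCost {X : Type*} [PseudoMetricSpace X] [CompactSpace X] [MeasurableSpace X]
    [BorelSpace X] {c : X → X → ℝ} (hcm : Measurable (Function.uncurry c))
    (hc : ∀ x y, 0 ≤ c x y) {K : ℝ} (hK : 0 < K) (hcK : ∀ x y, c x y ≤ K * dist x y)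
    (μ : ProbabilityMeasure X) : Tendsto (fun ν => transportCost c μ ν) (𝓝 μ) (𝓝 0) := by
  have hM0 : 0 ≤ K * Metric.diam (univ : Set X) := mul_nonneg hK.le Metric.diam_nonneg
  have hM : ∀ x y, c x y ≤ K * Metric.diam (univ : Set X) := fun x y =>
    (hcK x y).trans <| mul_le_mul_of_nonneg_left
      (Metric.dist_le_diam_of_mem isCompact_univ.isBounded (mem_univ _) (mem_univ _)) hK.le
  refine tendsto_order.2 ⟨fun a ha => Eventually.of_forall fun ν =>
    ha.trans_le (transportCost_nonneg hc _ _), fun ε hε => ?_⟩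
  obtain ⟨N, B, hB, hfr, hdisj, hun, hdist⟩ :=
    exists_null_frontier_partition (μ : Measure X) (div_pos (half_pos hε) hK)
  have hcell : ∀ i, ∀ x ∈ B i, ∀ y ∈ B i, c x y ≤ ε / 2 := fun i x hx y hy =>
    (hcK x y).trans <| by
      have := mul_le_mul_of_nonneg_left (hdist i x hx y hy) hK.le
      rwa [mul_div_cancel₀ _ hK.ne'] at this
  -- The cells have `μ`-null frontier, so their masses converge under weak convergence and the
  -- excess mass tends to zero.
  have hlim : Tendsto (fun ν : ProbabilityMeasure X => ε / 2 +
      ((∑ i ∈ Finset.range N, (μ (B i) - ν (B i)) : ℝ≥0) : ℝ) * (K * Metric.diam (univ : Set X)))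
      (𝓝 μ) (𝓝 (ε / 2 + ((∑ i ∈ Finset.range N, (μ (B i) - μ (B i)) : ℝ≥0) : ℝ) *
        (K * Metric.diam (univ : Set X)))) := by
    refine tendsto_const_nhds.add (Tendsto.mul_const _ (NNReal.tendsto_coe.2 ?_))
    refine tendsto_finsetSum _ fun i _ => tendsto_const_nhds.sub ?_
    exact ProbabilityMeasure.tendsto_measure_of_null_frontier_of_tendsto tendsto_id
      ((ProbabilityMeasure.null_iff_toMeasure_null μ _).2 (hfr i))
  have hlt := hlim.eventually_lt_const (u := ε) (by simpa using hε)
  filter_upwards [hlt] with ν hν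
  obtain ⟨Γ, hΓ, hle⟩ := exists_isCoupling_integral_le hB hdisj hun hcm hc hM hM0 (half_pos hε).le
    hcell μ ν
  exact (transportCost_le hc hΓ).trans_lt (hle.trans_lt hν)

end TransportCost

/-! ### Wasserstein-Lipschitz functions are weakly continuous -/

section Wasserstein

variable {S A : Type*} [MetricSpace S] [CompactSpace S] [MeasurableSpace S] [BorelSpace S]
  [MetricSpace A] [CompactSpace A] [MeasurableSpace A] [BorelSpace A]

theorem tendsto_wasserstein (μ : ProbabilityMeasure S) :
    Tendsto (fun ν => wasserstein μ ν) (𝓝 μ) (𝓝 0) :=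
  tendsto_transportCost (by exact measurable_dist) (fun _ _ => dist_nonneg) one_pos
    (fun x y => (one_mul (dist x y)).ge) μ

theorem tendsto_wassersteinProd (Λ : ProbabilityMeasure (S × A)) :
    Tendsto (fun Λ' => wassersteinProd Λ Λ') (𝓝 Λ) (𝓝 0) := by
  -- The product carries the maximum metric, which dominates the sum of the distances up to the
  -- factor 2.
  refine tendsto_transportCost ?_ (fun _ _ => by positivity) two_pos (fun x y => ?_) Λ
  · exact (by fun_prop : Continuous fun z : (S × A) × (S × A) =>
      dist z.1.1 z.2.1 + dist z.1.2 z.2.2).measurable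
  · rw [Prod.dist_eq, two_mul]
    exact add_le_add (le_max_left _ _) (le_max_right _ _)

/-- The limit `0` along the neighbourhoods of `Λ` is also the limit along the pure filter at `Λ`,
which is the value there. -/
theorem wassersteinProd_self (Λ : ProbabilityMeasure (S × A)) : wassersteinProd Λ Λ = 0 :=
  tendsto_nhds_unique (tendsto_pure_nhds (fun Λ' => wassersteinProd Λ Λ') Λ)
    ((tendsto_wassersteinProd Λ).mono_left (pure_le_nhds Λ))

theorem continuous_of_abs_sub_le_wassersteinProd {h : ProbabilityMeasure (S × A) → ℝ} {C : ℝ}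
    (hh : ∀ Λ Λ', |h Λ - h Λ'| ≤ C * wassersteinProd Λ Λ') : Continuous h := by
  refine continuous_iff_continuousAt.2 fun Λ => tendsto_iff_dist_tendsto_zero.2 ?_
  refine squeeze_zero (fun _ => dist_nonneg) (fun Λ' => ?_)
    (by simpa using (tendsto_wassersteinProd Λ).const_mul C)
  rw [dist_comm, Real.dist_eq]
  exact hh Λ Λ'

theorem continuous_of_mem_lipB {L : ℝ} {V : ProbabilityMeasure S → ℝ} (hV : V ∈ LipB S L) :
    Continuous V := by
  refine continuous_iff_continuousAt.2 fun μ => tendsto_iff_dist_tendsto_zero.2 ?_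
  refine squeeze_zero (fun _ => dist_nonneg) (fun ν => ?_)
    (by simpa using (tendsto_wasserstein μ).const_mul L)
  rw [dist_comm, Real.dist_eq]
  exact hV.2 μ ν

end Wasserstein

/-! ### Lipschitz estimates for the lifted transition and reward -/

section Model

variable {S A E E₀ : Type*}
  [MetricSpace S] [CompactSpace S] [MeasurableSpace S] [BorelSpace S]
  [MetricSpace A] [CompactSpace A] [MeasurableSpace A] [BorelSpace A]
  [MeasurableSpace E] [MetricSpace E₀] [MeasurableSpace E₀]

/-- Synchronous coupling: both copies receive the same noise `e`. The factor 2 appears because `Λ`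
acts twice, as the law of `(s, a)` and as an argument of `F`. -/
theorem wasserstein_liftedF_le (lamE : ProbabilityMeasure E)
    {F : S × A × ProbabilityMeasure (S × A) × E × E₀ → S} (hF : Measurable F) {C : ℝ} (hC : 0 < C)
    (hLip : ∀ (s s' : S) (a a' : A) (Λ Λ' : ProbabilityMeasure (S × A)) (e₀ e₀' : E₀),
      ∫ e, dist (F (s, a, Λ, e, e₀)) (F (s', a', Λ', e, e₀')) ∂(lamE : Measure E) ≤
        C * (dist s s' + dist a a' + wassersteinProd Λ Λ' + dist e₀ e₀'))
    (x x' : GraphU S A) (e₀ e₀' : E₀) :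
    wasserstein (liftedF lamE hF x e₀) (liftedF lamE hF x' e₀') ≤
      C * (2 * wassersteinProd x.law x'.law + dist e₀ e₀') := by
  -- Only the first copy of the distance is replaced by the cost of a coupling `Γ`; the second comes
  -- from the argument of `F` and stays constant.
  suffices h : wasserstein (liftedF lamE hF x e₀) (liftedF lamE hF x' e₀') ≤
      C * wassersteinProd x.law x'.law + C * (wassersteinProd x.law x'.law + dist e₀ e₀') by
    linarith
  refine le_mul_transportCost_add hC fun Γ hΓ => ?_
  let Φ : ((S × A) × (S × A)) × E → S × S := fun z =>
    (F (z.1.1.1, z.1.1.2, x.law, z.2, e₀), F (z.1.2.1, z.1.2.2, x'.law, z.2, e₀'))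
  have hΦ : Measurable Φ :=
    (hF.comp (by fun_prop : Measurable fun z : ((S × A) × (S × A)) × E =>
      (z.1.1.1, z.1.1.2, x.law, z.2, e₀))).prodMk
    (hF.comp (by fun_prop : Measurable fun z : ((S × A) × (S × A)) × E =>
      (z.1.2.1, z.1.2.2, x'.law, z.2, e₀')))
  have hprod : ∀ {f : (S × A) × (S × A) → S × A} (hf : Measurable f)
      {Λ : ProbabilityMeasure (S × A)} (hΛ : Γ.map hf.aemeasurable = Λ),
      ((Γ : Measure ((S × A) × (S × A))).prod (lamE : Measure E)).map (Prod.map f id) =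
        (Λ : Measure (S × A)).prod (lamE : Measure E) := by
    intro f hf Λ hΛ
    rw [← Measure.map_prod_map _ _ hf measurable_id, Measure.map_id, ← hΛ]
    rfl
  have hcoup : IsCoupling (liftedF lamE hF x e₀) (liftedF lamE hF x' e₀')
      ((Γ.prod lamE).map hΦ.aemeasurable) := by
    constructor <;> refine Subtype.ext ?_
    · change Measure.map Prod.fst (Measure.map Φ _) =
        Measure.map _ ((x.law : Measure (S × A)).prod (lamE : Measure E))
      rw [Measure.map_map measurable_fst hΦ, ← hprod measurable_fst hΓ.1,
        Measure.map_map (measurable_section hF _ _) (by fun_prop)]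
      rfl
    · change Measure.map Prod.snd (Measure.map Φ _) =
        Measure.map _ ((x'.law : Measure (S × A)).prod (lamE : Measure E))
      rw [Measure.map_map measurable_snd hΦ, ← hprod measurable_snd hΓ.2,
        Measure.map_map (measurable_section hF _ _) (by fun_prop)]
      rfl
  have hbdd : ∀ y z : S, ‖dist y z‖ ≤ Metric.diam (univ : Set S) := fun y z => by
    rw [Real.norm_of_nonneg dist_nonneg]
    exact Metric.dist_le_diam_of_mem isCompact_univ.isBounded (mem_univ _) (mem_univ _)
  have hint : Integrable (fun w => dist (Φ w).1 (Φ w).2)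
      ((Γ : Measure ((S × A) × (S × A))).prod (lamE : Measure E)) :=
    Integrable.of_bound (measurable_dist.comp hΦ).aestronglyMeasurable _
      (ae_of_all _ fun _ => hbdd _ _)
  have hcont : Continuous fun z : (S × A) × (S × A) => dist z.1.1 z.2.1 + dist z.1.2 z.2.2 := by
    fun_prop
  have hcost : Integrable (fun z : (S × A) × (S × A) => dist z.1.1 z.2.1 + dist z.1.2 z.2.2)
      (Γ : Measure ((S × A) × (S × A))) :=
    (BoundedContinuousFunction.mkOfCompact ⟨_, hcont⟩).integrable _
  calc wasserstein (liftedF lamE hF x e₀) (liftedF lamE hF x' e₀')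
      ≤ ∫ z, dist z.1 z.2 ∂(((Γ.prod lamE).map hΦ.aemeasurable : ProbabilityMeasure (S × S)) :
          Measure (S × S)) := transportCost_le (fun _ _ => dist_nonneg) hcoup
    _ = ∫ w, dist (Φ w).1 (Φ w).2 ∂(Γ : Measure ((S × A) × (S × A))).prod (lamE : Measure E) :=
        integral_map hΦ.aemeasurable continuous_dist.aestronglyMeasurable
    _ = ∫ z, ∫ e, dist (Φ (z, e)).1 (Φ (z, e)).2 ∂(lamE : Measure E)
          ∂(Γ : Measure ((S × A) × (S × A))) := integral_prod _ hint
    _ ≤ ∫ z, (C * (dist z.1.1 z.2.1 + dist z.1.2 z.2.2) +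
          C * (wassersteinProd x.law x'.law + dist e₀ e₀')) ∂(Γ : Measure ((S × A) × (S × A))) :=
        integral_mono hint.integral_prod_left
          ((hcost.const_mul C).add (integrable_const _)) fun z =>
            (hLip z.1.1 z.2.1 z.1.2 z.2.2 _ _ e₀ e₀').trans_eq (by ring)
    _ = C * ∫ z, (dist z.1.1 z.2.1 + dist z.1.2 z.2.2) ∂(Γ : Measure ((S × A) × (S × A))) +
          C * (wassersteinProd x.law x'.law + dist e₀ e₀') := by
        rw [integral_add (hcost.const_mul C) (integrable_const _), integral_const_mul]
        simp

/-- Again `Λ` acts as integrating law and as argument of `r`, so integrating the Lipschitz bound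
over couplings gives the constant `2 * C`. -/
theorem continuous_liftedReward {r : S × A × ProbabilityMeasure (S × A) → ℝ} (hr : Measurable r)
    (hrLip : LipschitzReward r) :
    Continuous fun Λ : ProbabilityMeasure (S × A) => ∫ z, r (z.1, z.2, Λ) ∂(Λ : Measure (S × A)) := by
  obtain ⟨C, hC, hLip⟩ := hrLip
  refine continuous_of_abs_sub_le_wassersteinProd (C := C * 2) fun Λ Λ' => ?_
  suffices h : |∫ z, r (z.1, z.2, Λ) ∂(Λ : Measure (S × A)) -
      ∫ z, r (z.1, z.2, Λ') ∂(Λ' : Measure (S × A))| ≤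
      C * wassersteinProd Λ Λ' + C * wassersteinProd Λ Λ' by linarith
  refine le_mul_transportCost_add hC fun Γ hΓ => ?_
  have hmeas : ∀ Θ : ProbabilityMeasure (S × A), Measurable fun z : S × A => r (z.1, z.2, Θ) :=
    fun Θ => hr.comp (by fun_prop)
  obtain ⟨z₀⟩ : Nonempty (S × A) := Λ.nonempty
  have hint : ∀ (Θ : ProbabilityMeasure (S × A)) {f : (S × A) × (S × A) → S × A},
      Measurable f → Integrable (fun z => r ((f z).1, (f z).2, Θ))
        (Γ : Measure ((S × A) × (S × A))) := fun Θ f hf => by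
    refine Integrable.of_bound ((hmeas Θ).comp hf).aestronglyMeasurable
      (C * (Metric.diam (univ : Set S) + Metric.diam (univ : Set A) + wassersteinProd Θ Θ) +
        |r (z₀.1, z₀.2, Θ)|) (ae_of_all _ fun z => ?_)
    have h1 := abs_sub_abs_le_abs_sub (r ((f z).1, (f z).2, Θ)) (r (z₀.1, z₀.2, Θ))
    have h2 := hLip (f z).1 z₀.1 (f z).2 z₀.2 Θ Θ
    have h3 : dist (f z).1 z₀.1 ≤ Metric.diam (univ : Set S) :=
      Metric.dist_le_diam_of_mem isCompact_univ.isBounded (mem_univ _) (mem_univ _)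
    have h4 : dist (f z).2 z₀.2 ≤ Metric.diam (univ : Set A) :=
      Metric.dist_le_diam_of_mem isCompact_univ.isBounded (mem_univ _) (mem_univ _)
    have h5 := mul_le_mul_of_nonneg_left
      (add_le_add_left (add_le_add h3 h4) (wassersteinProd Θ Θ)) hC.le
    rw [Real.norm_eq_abs]
    linarith
  have hcont : Continuous fun z : (S × A) × (S × A) => dist z.1.1 z.2.1 + dist z.1.2 z.2.2 := by
    fun_prop
  have hcost : Integrable (fun z : (S × A) × (S × A) => dist z.1.1 z.2.1 + dist z.1.2 z.2.2)
      (Γ : Measure ((S × A) × (S × A))) :=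
    (BoundedContinuousFunction.mkOfCompact ⟨_, hcont⟩).integrable _
  have hmarg : ∀ {f : (S × A) × (S × A) → S × A} (hf : Measurable f)
      {Θ : ProbabilityMeasure (S × A)} (hΘ : Γ.map hf.aemeasurable = Θ),
      ∫ z, r (z.1, z.2, Θ) ∂(Θ : Measure (S × A)) =
        ∫ w, r ((f w).1, (f w).2, Θ) ∂(Γ : Measure ((S × A) × (S × A))) := fun {f} hf {Θ} hΘ => by
    -- Only the integrating measure is rewritten; `Θ` as an argument of `r` must stay.
    conv_lhs => rw [← congrArg ProbabilityMeasure.toMeasure hΘ]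
    exact integral_map hf.aemeasurable (hmeas Θ).aestronglyMeasurable
  rw [hmarg measurable_fst hΓ.1, hmarg measurable_snd hΓ.2,
    ← integral_sub (hint Λ measurable_fst) (hint Λ' measurable_snd)]
  calc |∫ w, (r (w.1.1, w.1.2, Λ) - r (w.2.1, w.2.2, Λ')) ∂(Γ : Measure ((S × A) × (S × A)))|
      ≤ ∫ w, |r (w.1.1, w.1.2, Λ) - r (w.2.1, w.2.2, Λ')| ∂(Γ : Measure ((S × A) × (S × A))) :=
        abs_integral_le_integral_abs
    _ ≤ ∫ z, (C * (dist z.1.1 z.2.1 + dist z.1.2 z.2.2) + C * wassersteinProd Λ Λ')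
          ∂(Γ : Measure ((S × A) × (S × A))) :=
        integral_mono ((hint Λ measurable_fst).sub (hint Λ' measurable_snd)).abs
          ((hcost.const_mul C).add (integrable_const _)) fun z =>
            (hLip z.1.1 z.2.1 z.1.2 z.2.2 Λ Λ').trans_eq (by ring)
    _ = C * ∫ z, (dist z.1.1 z.2.1 + dist z.1.2 z.2.2) ∂(Γ : Measure ((S × A) × (S × A))) +
          C * wassersteinProd Λ Λ' := by
        rw [integral_add (hcost.const_mul C) (integrable_const _), integral_const_mul]
        simp

end Model

/-! ### Joint continuity of the lifted expectation -/

section Lifted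

variable {S A E E₀ : Type*}
  [MetricSpace S] [CompactSpace S] [MeasurableSpace S] [BorelSpace S]
  [MetricSpace A] [CompactSpace A] [MeasurableSpace A] [BorelSpace A]
  [MeasurableSpace E] [MetricSpace E₀] [MeasurableSpace E₀] [BorelSpace E₀]

/-- The expectation of a bounded Wasserstein-Lipschitz function under the lifted kernel is jointly
continuous. -/
theorem continuous_integral_liftedKernel (lamE : ProbabilityMeasure E)
    {F : S × A × ProbabilityMeasure (S × A) × E × E₀ → S} (hF : Measurable F)
    (hFLip : LipschitzTransition lamE F) {L : ℝ} (hL : 0 ≤ L) {V : ProbabilityMeasure S → ℝ}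
    (hV : V ∈ LipB S L) :
    Continuous fun z : ProbabilityMeasure (S × A) × ProbabilityMeasure E₀ =>
      ∫ μ', V μ' ∂(liftedKernel lamE hF (GraphU.mk (pjS z.1) z.1 rfl) z.2 :
        Measure (ProbabilityMeasure S)) := by
  obtain ⟨C, hC, hLip⟩ := hFLip
  have hVc := continuous_of_mem_lipB hV
  obtain ⟨⟨M, hM⟩, hVL⟩ := hV
  let g : ProbabilityMeasure (S × A) → E₀ → ℝ := fun Λ e₀ =>
    V (liftedF lamE hF (GraphU.mk (pjS Λ) Λ rfl) e₀)
  have hg : ∀ Λ Λ' e₀ e₀', |g Λ e₀ - g Λ' e₀'| ≤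
      L * (C * (2 * wassersteinProd Λ Λ' + dist e₀ e₀')) := fun Λ Λ' e₀ e₀' =>
    (hVL _ _).trans (mul_le_mul_of_nonneg_left (wasserstein_liftedF_le lamE hF hC hLip _ _ _ _) hL)
  have hgc : ∀ Λ, Continuous (g Λ) := fun Λ => by
    refine (LipschitzWith.of_dist_le' (K := L * C) fun e₀ e₀' => ?_).continuous
    have := hg Λ Λ e₀ e₀'
    rw [wassersteinProd_self, mul_zero, zero_add, ← mul_assoc] at this
    rwa [Real.dist_eq]
  let gB : ProbabilityMeasure (S × A) → BoundedContinuousFunction E₀ ℝ := fun Λ =>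
    BoundedContinuousFunction.ofNormedAddCommGroup (g Λ) (hgc Λ) M fun _ => hM _
  have hint : ∀ Λ (p : ProbabilityMeasure E₀), Integrable (g Λ) (p : Measure E₀) := fun Λ p =>
    (gB Λ).integrable _
  have heq : ∀ z : ProbabilityMeasure (S × A) × ProbabilityMeasure E₀,
      ∫ μ', V μ' ∂(liftedKernel lamE hF (GraphU.mk (pjS z.1) z.1 rfl) z.2 :
        Measure (ProbabilityMeasure S)) = ∫ e₀, g z.1 e₀ ∂(z.2 : Measure E₀) := fun z =>
    integral_map (measurable_liftedF lamE hF _).aemeasurable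
      hVc.measurable.aestronglyMeasurable
  simp only [heq]
  refine continuous_iff_continuousAt.2 fun ⟨Λ, p⟩ => tendsto_iff_dist_tendsto_zero.2 ?_
  -- The bound passes through the integral of `g Λ` against `z.2`: changing `Λ` costs an amount
  -- uniform in `e₀`, and changing `p` tests weak convergence on the fixed bounded continuous
  -- function `g Λ`.
  have hlim : Tendsto (fun z : ProbabilityMeasure (S × A) × ProbabilityMeasure E₀ =>
      L * (C * (2 * wassersteinProd Λ z.1)) +
        dist (∫ e₀, g Λ e₀ ∂(p : Measure E₀)) (∫ e₀, g Λ e₀ ∂(z.2 : Measure E₀)))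
      (𝓝 (Λ, p)) (𝓝 (L * (C * (2 * 0)) +
        dist (∫ e₀, g Λ e₀ ∂(p : Measure E₀)) (∫ e₀, g Λ e₀ ∂(p : Measure E₀)))) := by
    refine Tendsto.add ?_ (tendsto_const_nhds.dist ?_)
    · exact (((((tendsto_wassersteinProd Λ).comp (continuous_fst.tendsto (Λ, p)))).const_mul
        2).const_mul C).const_mul L
    · exact ((ProbabilityMeasure.continuous_integral_boundedContinuousFunction (gB Λ)).comp
        continuous_snd).tendsto (Λ, p)
  simp only [mul_zero, dist_self, add_zero] at hlim
  refine squeeze_zero (fun _ => dist_nonneg) (fun z => ?_) hlim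
  rw [dist_comm]
  refine (dist_triangle _ (∫ e₀, g Λ e₀ ∂(z.2 : Measure E₀)) _).trans ?_
  rw [add_comm]
  refine add_le_add_left ?_ _
  rw [Real.dist_eq, ← integral_sub (hint _ _) (hint _ _)]
  calc |∫ e₀, (g Λ e₀ - g z.1 e₀) ∂(z.2 : Measure E₀)|
      ≤ ∫ e₀, |g Λ e₀ - g z.1 e₀| ∂(z.2 : Measure E₀) := abs_integral_le_integral_abs
    _ ≤ ∫ _, L * (C * (2 * wassersteinProd Λ z.1)) ∂(z.2 : Measure E₀) :=
        integral_mono ((hint _ _).sub (hint _ _)).abs (integrable_const _) fun e₀ => by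
          simpa using hg Λ z.1 e₀ e₀
    _ = L * (C * (2 * wassersteinProd Λ z.1)) := by simp

theorem continuous_pjS : Continuous (pjS : ProbabilityMeasure (S × A) → ProbabilityMeasure S) :=
  ProbabilityMeasure.continuous_map continuous_fst

theorem admissible_nonempty [Nonempty A] (μ : ProbabilityMeasure S) : (admissible A μ).Nonempty :=
  ⟨μ.prod ⟨Measure.dirac (Classical.arbitrary A), inferInstance⟩, by
    apply Subtype.ext
    change ((μ : Measure S).prod (Measure.dirac (Classical.arbitrary A))).map Prod.fst = μ
    simp⟩

end Lifted

end RobustMFC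

/-! ### The two measurable selections -/

theorem proposition2p4
    {S A E E₀ : Type*}
    [MetricSpace S] [CompactSpace S] [Nonempty S] [MeasurableSpace S] [BorelSpace S]
    [MetricSpace A] [CompactSpace A] [Nonempty A] [MeasurableSpace A] [BorelSpace A]
    [TopologicalSpace E] [PolishSpace E] [MeasurableSpace E] [BorelSpace E]
    [MetricSpace E₀] [PolishSpace E₀] [MeasurableSpace E₀] [BorelSpace E₀]
    (lamE : ProbabilityMeasure E)
    (F : S × A × ProbabilityMeasure (S × A) × E × E₀ → S) (hF : Measurable F)
    (r : S × A × ProbabilityMeasure (S × A) → ℝ) (hr : Measurable r)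
    (β : ℝ) (hβ0 : 0 ≤ β) (hβ1 : β < 1)
    (P0 : Set (ProbabilityMeasure E₀)) (hP0 : P0.Nonempty)
    (hP0c : IsCompact P0)
    (hFLip : RobustMFC.LipschitzTransition lamE F)
    (hrLip : RobustMFC.LipschitzReward r)
    (L : ℝ) (hL : 0 ≤ L)
    (V : ProbabilityMeasure S → ℝ) (hV : V ∈ RobustMFC.LipB S L) :
    (∃ pStar : ProbabilityMeasure (S × A) → ProbabilityMeasure E₀,
      Measurable pStar ∧ (∀ Λ, pStar Λ ∈ P0) ∧
      ∀ Λ : ProbabilityMeasure (S × A),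
        ∫ μ', V μ' ∂(RobustMFC.liftedKernel lamE hF
            (RobustMFC.GraphU.mk (RobustMFC.pjS Λ) Λ rfl) (pStar Λ) :
              Measure (ProbabilityMeasure S)) =
          ⨅ p : P0, ∫ μ', V μ' ∂(RobustMFC.liftedKernel lamE hF
            (RobustMFC.GraphU.mk (RobustMFC.pjS Λ) Λ rfl) p.1 :
              Measure (ProbabilityMeasure S))) ∧
    (∃ piStar : ProbabilityMeasure S → ProbabilityMeasure (S × A),
      Measurable piStar ∧
      ∃ hpi : ∀ μ, piStar μ ∈ RobustMFC.admissible A μ,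
        ∀ μ : ProbabilityMeasure S,
          RobustMFC.liftedReward r (RobustMFC.GraphU.mk μ (piStar μ) (hpi μ)) +
            β * (⨅ p : P0, ∫ μ', V μ' ∂(RobustMFC.liftedKernel lamE hF
              (RobustMFC.GraphU.mk μ (piStar μ) (hpi μ)) p.1 :
                Measure (ProbabilityMeasure S))) =
          RobustMFC.bellmanIsaacs lamE hF r β P0 V μ) := by

  have hGc := RobustMFC.continuous_integral_liftedKernel lamE hF hFLip hL hV
  set G : ProbabilityMeasure (S × A) × ProbabilityMeasure E₀ → ℝ := fun z =>
    ∫ μ', V μ' ∂(RobustMFC.liftedKernel lamE hF (RobustMFC.GraphU.mk (RobustMFC.pjS z.1) z.1 rfl)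
      z.2 : Measure (ProbabilityMeasure S)) with hG
  haveI : CompactSpace P0 := isCompact_iff_compactSpace.1 hP0c
  haveI : Nonempty P0 := hP0.to_subtype
  have hbdd : ∀ Λ, BddBelow (range fun p : P0 => G (Λ, p.1)) := fun Λ =>
    (isCompact_range (by fun_prop : Continuous fun p : P0 => G (Λ, p.1))).bddBelow
  let h : ProbabilityMeasure (S × A) → ℝ := fun Λ => ⨅ p : P0, G (Λ, p.1)
  have hh : Continuous h := by
    have := hP0c.continuous_sInf (f := fun Λ p => G (Λ, p)) hGc
    simpa only [sInf_image'] using this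
  have hmin : ∀ Λ, ∃ p : P0, G (Λ, p.1) = h Λ := fun Λ => by
    obtain ⟨p, -, hp⟩ := (isCompact_univ (X := P0)).exists_isMinOn univ_nonempty
      (by fun_prop : Continuous fun p : P0 => G (Λ, p.1)).continuousOn
    exact ⟨p, le_antisymm (le_ciInf fun q => hp (mem_univ q)) (ciInf_le (hbdd Λ) p)⟩
  refine ⟨?_, ?_⟩
  -- Here the objective depends on the parameter `Λ`, so optimality is put into the correspondence
  -- and the minimized function is constant.
  · obtain ⟨s, hs, hs'⟩ := RobustMFC.exists_measurable_minimizer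
      (Y := ProbabilityMeasure (S × A)) (K := P0) (φ := fun Λ => {p | G (Λ, p.1) = h Λ})
      (f := fun _ => 0)
      (isClosed_eq (f := fun z : ProbabilityMeasure (S × A) × P0 => G (z.1, z.2.1))
        (by fun_prop) (by fun_prop)) hmin continuous_const
    exact ⟨fun Λ => (s Λ).1, measurable_subtype_coe.comp hs, fun Λ => (s Λ).2, fun Λ => (hs' Λ).1⟩
  -- Since `μ` is the marginal of `Λ`, the objective is a function of `Λ` alone; `μ` enters only
  -- through the constraint.
  · let J : ProbabilityMeasure (S × A) → ℝ := fun Λ =>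
      ∫ z, r (z.1, z.2, Λ) ∂(Λ : Measure (S × A)) + β * h Λ
    have hJ : Continuous J := (RobustMFC.continuous_liftedReward hr hrLip).add
      (continuous_const.mul hh)
    obtain ⟨s, hs, hs'⟩ := RobustMFC.exists_measurable_minimizer
      (Y := ProbabilityMeasure S) (K := ProbabilityMeasure (S × A))
      (φ := fun μ => RobustMFC.admissible A μ) (f := fun Λ => -J Λ)
      (isClosed_eq (f := fun z : ProbabilityMeasure S × ProbabilityMeasure (S × A) =>
        RobustMFC.pjS z.2) (RobustMFC.continuous_pjS.comp continuous_snd) continuous_fst)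
      RobustMFC.admissible_nonempty hJ.neg
    have hval : ∀ μ Λ (hΛ : Λ ∈ RobustMFC.admissible A μ),
        RobustMFC.liftedReward r (RobustMFC.GraphU.mk μ Λ hΛ) +
          β * RobustMFC.worstCase lamE hF P0 V (RobustMFC.GraphU.mk μ Λ hΛ) = J Λ := by
      rintro _ Λ rfl
      rfl
    refine ⟨s, hs, fun μ => (hs' μ).1, fun μ => ?_⟩
    haveI : Nonempty (RobustMFC.admissible A μ) := ⟨⟨s μ, (hs' μ).1⟩⟩
    have hle : ∀ Λ : RobustMFC.admissible A μ, J Λ.1 ≤ J (s μ) := fun Λ =>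
      neg_le_neg_iff.1 ((hs' μ).2 Λ.1 Λ.2)
    have hT : RobustMFC.bellmanIsaacs lamE hF r β P0 V μ =
        ⨆ Λ : RobustMFC.admissible A μ, J Λ.1 := iSup_congr fun Λ => hval μ Λ.1 Λ.2
    rw [hT]
    refine (hval μ (s μ) (hs' μ).1).trans (le_antisymm ?_ (ciSup_le hle))
    exact le_ciSup (f := fun Λ : RobustMFC.admissible A μ => J Λ.1)
      ⟨J (s μ), by rintro _ ⟨Λ, rfl⟩; exact hle Λ⟩ ⟨s μ, (hs' μ).1⟩
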